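/- Let $G$ be a group. An automorphism $f$ of $G$ is called a *conjugating automorphism* if $f(g)$ is a conjugate of $g$ for every $g\in G$. The conjugating automorphisms form a subgroup ${\rm Conj}(G)$ of ${\rm Aut}(G)$, which contains the group ${\rm Inn}(G)$ of inner automorphisms. A geodesic metric space is $\delta$-*hyperbolic* ($\delta\ge 0$) if in every triangle with geodesic sides each side is contained in the $\delta$-neighbourhood of the union of the two other sides. The group $G$ is *hyperbolic* if it has a finite generating set $S$, closed under inverses, such that the Cayley graph $X(G,S)$, regarded as a geodesic metric space in which every edge has length one, is $\delta$-hyperbolic for some $\delta\ge 0$. **Lemma.** Let $G$ be a hyperbolic group. Then the group ${\rm Inn}(G)$ of inner automorphisms of $G$ is of finite index in ${\rm Conj}(G)$. -/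

import Mathlib

/-! ## Hyperbolic metric spaces -/

/-- `A` is a geodesic segment (a geodesic side) joining `x` to `y` in the metric space `X`:
the image of a path `γ : [0, ℓ] → X` from `x` to `y` which preserves distances. -/
def IsGeodesicSegment {X : Type*} [MetricSpace X] (A : Set X) (x y : X) : Prop :=
  ∃ (ℓ : ℝ) (γ : ℝ → X), 0 ≤ ℓ ∧ γ 0 = x ∧ γ ℓ = y ∧
    (∀ s ∈ Set.Icc 0 ℓ, ∀ t ∈ Set.Icc 0 ℓ, dist (γ s) (γ t) = |s - t|) ∧
    A = γ '' Set.Icc 0 ℓ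

/-- `A` is contained in the (closed) `δ`-neighbourhood of `B`. -/
def ContainedInNeighbourhood {X : Type*} [MetricSpace X] (δ : ℝ) (A B : Set X) : Prop :=
  ∀ p ∈ A, ∃ q ∈ B, dist p q ≤ δ

/-- A (geodesic) metric space `X` is `δ`-hyperbolic if in every triangle with geodesic sides,
each side is contained in the `δ`-neighbourhood of the union of the two other sides. -/
def IsDeltaHyperbolic (X : Type*) [MetricSpace X] (δ : ℝ) : Prop :=
  ∀ (x y z : X) (A B C : Set X),
    IsGeodesicSegment A y z → IsGeodesicSegment B z x → IsGeodesicSegment C x y →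
      ContainedInNeighbourhood δ A (B ∪ C) ∧
      ContainedInNeighbourhood δ B (C ∪ A) ∧
      ContainedInNeighbourhood δ C (A ∪ B)

/-! ## The metric graph underlying a connected simple graph -/

/-- A closed cell of the graph `Γ`, given by its set of vertices: a single vertex or the two
endpoints of an edge (or the empty set). -/
def SimpleGraph.IsCell {V : Type*} (Γ : SimpleGraph V) (e : Finset V) : Prop :=
  Γ.IsClique (e : Set V) ∧ e.card ≤ 2

/-- The points of the geometric realization of the graph `Γ`, in barycentric coordinates: the
point at distance `t` from `u` on an edge `{u, v}` is `(1 - t) u + t v`, and a vertex `u` is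
the point all of whose weight is at `u`. -/
@[ext]
structure SimpleGraph.Realization {V : Type*} (Γ : SimpleGraph V) where
  /-- the barycentric coordinates -/
  coord : V →₀ ℝ
  coord_nonneg : ∀ v, 0 ≤ coord v
  coord_sum : (coord.sum fun _ r => r) = 1
  isCell_support : Γ.IsCell coord.support

namespace SimpleGraph.Realization

variable {V : Type*} {Γ : SimpleGraph V}

/-- The vertex `v` as a point of the realization. -/
noncomputable def vertex (Γ : SimpleGraph V) (v : V) : Γ.Realization where
  coord := Finsupp.single v 1
  coord_nonneg w := by
    classical
    rw [Finsupp.single_apply]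
    split_ifs <;> norm_num
  coord_sum := by simp
  isCell_support := by
    rw [Finsupp.support_single v (one_ne_zero : (1 : ℝ) ≠ 0)]
    constructor <;> simp

/-- The points `x` and `y` lie on a common closed edge of `Γ` (or are the same vertex). -/
def OnCommonCell (x y : Γ.Realization) : Prop :=
  ∃ e : Finset V, Γ.IsCell e ∧ x.coord.support ⊆ e ∧ y.coord.support ⊆ e

/-- Half the `ℓ¹`-distance of the barycentric coordinates. For two points
`(1 - s) u + s v` and `(1 - t) u + t v` of the same edge this is `|s - t|`, the length of the part
of the edge between them, every edge having length one. -/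
noncomputable def segmentLength (x y : Γ.Realization) : ℝ :=
  ((x.coord - y.coord).sum fun _ r => |r|) / 2

/-- `IsPathLength x y ℓ`: there is a piecewise linear path from `x` to `y` of length `ℓ`, that is, a
finite sequence of points from `x` to `y`, in which consecutive points lie on a common edge,
and whose segments have total length `ℓ`. -/
inductive IsPathLength : Γ.Realization → Γ.Realization → ℝ → Prop
  | nil (x : Γ.Realization) : IsPathLength x x 0
  | cons {x y z : Γ.Realization} {ℓ : ℝ} (hxy : OnCommonCell x y) (h : IsPathLength y z ℓ) :
      IsPathLength x z (segmentLength x y + ℓ)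

lemma segmentLength_comm (x y : Γ.Realization) : segmentLength x y = segmentLength y x := by
  unfold segmentLength
  rw [← neg_sub y.coord x.coord, Finsupp.sum_neg_index (by simp)]
  simp

lemma segmentLength_nonneg (x y : Γ.Realization) : 0 ≤ segmentLength x y :=
  div_nonneg (Finset.sum_nonneg fun _ _ => abs_nonneg _) zero_le_two

lemma abs_sub_le_segmentLength (x y : Γ.Realization) (v : V) :
    |x.coord v - y.coord v| ≤ 2 * segmentLength x y := by
  have h : |(x.coord - y.coord) v| ≤ (x.coord - y.coord).sum fun _ r => |r| := by
    by_cases hv : v ∈ (x.coord - y.coord).support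
    · exact Finset.single_le_sum (f := fun w => |(x.coord - y.coord) w|)
        (fun _ _ => abs_nonneg _) hv
    · rw [Finsupp.notMem_support_iff.mp hv, abs_zero]
      exact Finset.sum_nonneg fun _ _ => abs_nonneg _
  rw [Finsupp.sub_apply] at h
  unfold segmentLength
  linarith

lemma OnCommonCell.symm {x y : Γ.Realization} (h : OnCommonCell x y) : OnCommonCell y x := by
  obtain ⟨e, he, hx, hy⟩ := h
  exact ⟨e, he, hy, hx⟩

namespace IsPathLength

variable {x y z : Γ.Realization} {ℓ ℓ' : ℝ}

lemma nonneg (h : IsPathLength x y ℓ) : 0 ≤ ℓ := by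
  induction h with
  | nil x => exact le_rfl
  | cons _ _ ih => exact add_nonneg (segmentLength_nonneg _ _) ih

lemma abs_sub_le (h : IsPathLength x y ℓ) (v : V) : |x.coord v - y.coord v| ≤ 2 * ℓ := by
  induction h with
  | nil x => simp
  | @cons x y z ℓ _ _ ih =>
    have h₁ := _root_.abs_sub_le (x.coord v) (y.coord v) (z.coord v)
    have h₂ := abs_sub_le_segmentLength x y v
    linarith

lemma single (h : OnCommonCell x y) : IsPathLength x y (segmentLength x y) := by
  simpa using cons h (nil y)

lemma trans (h : IsPathLength x y ℓ) (h' : IsPathLength y z ℓ') :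
    IsPathLength x z (ℓ + ℓ') := by
  induction h with
  | nil x => simpa using h'
  | cons hxy _ ih =>
    rw [add_assoc]
    exact cons hxy (ih h')

lemma symm (h : IsPathLength x y ℓ) : IsPathLength y x ℓ := by
  induction h with
  | nil x => exact nil x
  | @cons x y z ℓ hxy _ ih =>
    rw [add_comm, segmentLength_comm]
    exact ih.trans (single hxy.symm)

end IsPathLength

lemma exists_isPathLength_vertex_of_walk {u v : V} (p : Γ.Walk u v) :
    ∃ ℓ, IsPathLength (vertex Γ u) (vertex Γ v) ℓ := by
  classical
  induction p with
  | nil => exact ⟨0, .nil _⟩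
  | @cons u v w h _ ih =>
    obtain ⟨ℓ, hℓ⟩ := ih
    refine ⟨_, .cons ⟨{u, v}, ⟨?_, Finset.card_le_two⟩, ?_, ?_⟩ hℓ⟩
    · simpa using fun _ => h
    · exact Finsupp.support_single_subset.trans (by simp)
    · exact Finsupp.support_single_subset.trans (by simp)

lemma exists_isPathLength_vertex (x : Γ.Realization) :
    ∃ v ℓ, IsPathLength x (vertex Γ v) ℓ := by
  have hne : x.coord.support.Nonempty := by
    by_contra h
    have h₁ := x.coord_sum
    rw [Finset.not_nonempty_iff_eq_empty, Finsupp.support_eq_empty] at h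
    simp [h] at h₁
  obtain ⟨v, hv⟩ := hne
  refine ⟨v, _, .single ⟨_, x.isCell_support, subset_rfl, ?_⟩⟩
  exact Finsupp.support_single_subset.trans (by simpa using hv)

lemma exists_isPathLength (hΓ : Γ.Connected) (x y : Γ.Realization) :
    ∃ ℓ, IsPathLength x y ℓ := by
  obtain ⟨u, ℓ₁, h₁⟩ := exists_isPathLength_vertex x
  obtain ⟨v, ℓ₂, h₂⟩ := exists_isPathLength_vertex y
  obtain ⟨p⟩ := hΓ.preconnected u v
  obtain ⟨ℓ, h⟩ := exists_isPathLength_vertex_of_walk p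
  exact ⟨_, (h₁.trans h).trans h₂.symm⟩

lemma bddBelow_isPathLength (x y : Γ.Realization) : BddBelow {ℓ | IsPathLength x y ℓ} :=
  ⟨0, fun _ h => h.nonneg⟩

/-- The path metric on the realization of a connected graph, every edge having length one: the
distance is the infimum of the lengths of the paths between the two points. -/
noncomputable abbrev metricSpace (hΓ : Γ.Connected) : MetricSpace Γ.Realization where
  dist x y := sInf {ℓ | IsPathLength x y ℓ}
  dist_self x :=
    le_antisymm (csInf_le (bddBelow_isPathLength x x) (.nil x))
      (le_csInf ⟨0, .nil x⟩ fun _ h => IsPathLength.nonneg h)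
  dist_comm x y := by
    congr 1
    ext ℓ
    exact ⟨fun h => h.symm, fun h => h.symm⟩
  dist_triangle x y z := by
    refine le_of_forall_pos_lt_add fun ε hε => ?_
    obtain ⟨a, ha, ha'⟩ := exists_lt_of_csInf_lt (exists_isPathLength hΓ x y)
      (lt_add_of_pos_right _ (half_pos hε))
    obtain ⟨b, hb, hb'⟩ := exists_lt_of_csInf_lt (exists_isPathLength hΓ y z)
      (lt_add_of_pos_right _ (half_pos hε))
    refine (csInf_le (bddBelow_isPathLength x z) (IsPathLength.trans ha hb)).trans_lt
      ((add_lt_add ha' hb').trans_eq ?_)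
    rw [add_add_add_comm, add_halves]
    rfl
  eq_of_dist_eq_zero {x y} h := by
    ext v
    have h₁ : |x.coord v - y.coord v| / 2 ≤ sInf {ℓ | IsPathLength x y ℓ} :=
      le_csInf (exists_isPathLength hΓ x y) fun ℓ hℓ => by
        have h₂ := IsPathLength.abs_sub_le hℓ v
        linarith
    rw [h] at h₁
    have h₃ : |x.coord v - y.coord v| = 0 :=
      le_antisymm (by linarith) (abs_nonneg _)
    exact sub_eq_zero.mp (abs_eq_zero.mp h₃)

end SimpleGraph.Realization

/-! ## Cayley graphs and hyperbolic groups -/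

lemma SimpleGraph.mulCayley_connected {G : Type*} [Group G] {S : Set G}
    (hS : Subgroup.closure S = ⊤) : (SimpleGraph.mulCayley S).Connected := by
  have step : ∀ x y : G, (x⁻¹ * y ∈ S ∨ y⁻¹ * x ∈ S) →
      (SimpleGraph.mulCayley S).Reachable x y := by
    intro x y h
    by_cases hxy : x = y
    · rw [hxy]
    · exact ((SimpleGraph.mulCayley_adj S x y).mpr ⟨hxy, h⟩).reachable
  have key : ∀ g : G, (SimpleGraph.mulCayley S).Reachable 1 g := by
    intro g
    have hg : g ∈ Subgroup.closure S := hS ▸ Subgroup.mem_top g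
    induction hg using Subgroup.closure_induction_right with
    | one => exact SimpleGraph.Reachable.refl _
    | mul_right x _ y hy ih => exact ih.trans (step _ _ (Or.inl (by simpa using hy)))
    | mul_inv_cancel x _ y hy ih => exact ih.trans (step _ _ (Or.inr (by simpa using hy)))
  have : Nonempty G := ⟨1⟩
  exact SimpleGraph.Connected.mk fun x y => (key x).symm.trans (key y)

/-- The Cayley graph `X(G, S)` of the group `G` with respect to the generating set `S`, as a
geodesic metric space. -/
def CayleySpace {G : Type*} [Group G] (S : Set G) (_hS : Subgroup.closure S = ⊤) : Type _ :=
  (SimpleGraph.mulCayley S).Realization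

/-- The metric on `X(G, S)` that extends the word metric: every edge has length one. -/
noncomputable instance CayleySpace.instMetricSpace {G : Type*} [Group G] (S : Set G)
    (hS : Subgroup.closure S = ⊤) : MetricSpace (CayleySpace S hS) :=
  SimpleGraph.Realization.metricSpace (SimpleGraph.mulCayley_connected hS)

/-- A group is hyperbolic if it has a finite generating set `S`, closed under inverses, such
that the Cayley graph `X(G, S)` is a `δ`-hyperbolic metric space for some `δ ≥ 0`. -/
def IsHyperbolicGroup (G : Type*) [Group G] : Prop :=
  ∃ (S : Set G) (hS : Subgroup.closure S = ⊤), S.Finite ∧ (∀ s ∈ S, s⁻¹ ∈ S) ∧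
    ∃ δ : ℝ, 0 ≤ δ ∧ IsDeltaHyperbolic (CayleySpace S hS) δ

/-! ## Conjugating automorphisms -/

/-- The group `Conj(G)` of conjugating automorphisms of `G`: the automorphisms `f` such that
`f g` is a conjugate of `g` for every `g`. -/
def conjAut (G : Type*) [Group G] : Subgroup (MulAut G) where
  carrier := {f | ∀ g : G, IsConj g (f g)}
  one_mem' g := IsConj.refl g
  mul_mem' {f f'} hf hf' g := (hf' g).trans (hf (f' g))
  inv_mem' {f} hf g := by
    have h := hf (f⁻¹ g)
    rw [MulAut.apply_inv_self] at h
    exact h.symm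

/-- The group `Inn(G)` of inner automorphisms of `G`, as a subgroup of `Aut(G)`. -/
def innAut (G : Type*) [Group G] : Subgroup (MulAut G) :=
  (MulAut.conj : G →* MulAut G).range

lemma innAut_le_conjAut (G : Type*) [Group G] : innAut G ≤ conjAut G := by
  rintro _ ⟨h, rfl⟩ g
  exact isConj_iff.mpr ⟨h, rfl⟩

/-! ## The four-point condition -/

/-! The core is a coarse form of Serre's lemma on trees: if two isometries and their product all
have fixed points, then the two have a common fixed point. Let `f` be conjugating and `S` the finite
generating set. Each `f s` is conjugate to `s`, and each `f s * f t = f (s * t)` is conjugate to `s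
* t`, so each of these moves some point of `G` by at most 2 in the word metric. Hyperbolicity turns
these separate points into a single `x` that every `f s` moves by an amount independent of `f`
(`FourPointCondition.exists_forall_dist_smul_le`).

Conjugating by `x⁻¹` then sends `S` into a fixed finite ball. An automorphism is determined by its
values on `S`, so only finitely many automorphisms arise this way, and each coset of `Inn(G)` in
`Conj(G)` contains one of them.

The coarse Serre lemma is proved by descent. While the maximal displacement is large, moving `x` a
fixed distance towards the image `g₀ • x` realizing it lowers all large displacements at once. This
works because the geodesics from `x` to the points `g • x`, `g⁻¹ • x` and `g₀ • x` start out
together, otherwise some product would translate too far (`dist_inv_smul_smul_le`). -/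

namespace IsGeodesicSegment

variable {X : Type*} [MetricSpace X] {A : Set X} {x y p : X}

lemma left_mem (h : IsGeodesicSegment A x y) : x ∈ A := by
  obtain ⟨ℓ, γ, hℓ, h0, -, -, rfl⟩ := h
  exact ⟨0, ⟨le_rfl, hℓ⟩, h0⟩

lemma right_mem (h : IsGeodesicSegment A x y) : y ∈ A := by
  obtain ⟨ℓ, γ, hℓ, -, h1, -, rfl⟩ := h
  exact ⟨ℓ, ⟨hℓ, le_rfl⟩, h1⟩

lemma dist_add_dist (h : IsGeodesicSegment A x y) (hp : p ∈ A) :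
    dist x p + dist p y = dist x y := by
  obtain ⟨ℓ, γ, hℓ, rfl, rfl, hγ, rfl⟩ := h
  obtain ⟨t, ht, rfl⟩ := hp
  have h0 : (0 : ℝ) ∈ Set.Icc 0 ℓ := ⟨le_rfl, hℓ⟩
  have h1 : ℓ ∈ Set.Icc 0 ℓ := ⟨hℓ, le_rfl⟩
  rw [hγ _ h0 _ ht, hγ _ ht _ h1, hγ _ h0 _ h1, abs_of_nonpos (by linarith [ht.1]),
    abs_of_nonpos (by linarith [ht.2]), abs_of_nonpos (by linarith)]
  ring

lemma isPreconnected (h : IsGeodesicSegment A x y) : IsPreconnected A := by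
  obtain ⟨ℓ, γ, -, -, -, hγ, rfl⟩ := h
  refine isPreconnected_Icc.image γ (LipschitzOnWith.continuousOn (K := 1) ?_)
  refine LipschitzOnWith.of_dist_le_mul fun s hs t ht => ?_
  rw [hγ s hs t ht, Real.dist_eq]
  simp

end IsGeodesicSegment

/-- Gromov's four-point condition. -/
def FourPointCondition (X : Type*) [PseudoMetricSpace X] (δ : ℝ) : Prop :=
  ∀ x y z w : X,
    dist x y + dist z w ≤ max (dist x z + dist y w) (dist x w + dist y z) + δ

namespace IsDeltaHyperbolic

variable {X : Type*} [MetricSpace X] {δ : ℝ}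

/-- In a triangle, some point of the side opposite to `x` is nearly as close to `x` as the
Gromov product of the other two vertices. -/
lemma exists_mem_two_mul_dist_le (hX : IsDeltaHyperbolic X δ) (hδ : 0 ≤ δ) {x y z : X}
    {A B C : Set X} (hA : IsGeodesicSegment A y z) (hB : IsGeodesicSegment B z x)
    (hC : IsGeodesicSegment C x y) :
    ∃ p ∈ A, 2 * dist x p ≤ dist x y + dist x z - dist y z + 4 * (δ + 1) := by
  have hδ' : 0 < δ + 1 := by linarith
  -- The side `A` is connected and covered by two open sets, each meeting it, so some `p` is close
  -- to both other sides. The radius `δ + 1` makes the closed `δ`-neighbourhoods fit into open ones.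
  obtain ⟨p, hpA, hpB, hpC⟩ := hA.isPreconnected (Metric.thickening (δ + 1) B)
    (Metric.thickening (δ + 1) C) Metric.isOpen_thickening Metric.isOpen_thickening
    (fun p hp => by
      rw [← Metric.thickening_union, Metric.mem_thickening_iff]
      obtain ⟨q, hq, hpq⟩ := (hX x y z A B C hA hB hC).1 p hp
      exact ⟨q, hq, by linarith⟩)
    ⟨z, hA.right_mem, Metric.self_subset_thickening hδ' _ hB.left_mem⟩
    ⟨y, hA.left_mem, Metric.self_subset_thickening hδ' _ hC.right_mem⟩
  rw [Metric.mem_thickening_iff] at hpB hpC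
  obtain ⟨q, hq, hpq⟩ := hpB
  obtain ⟨r, hr, hpr⟩ := hpC
  refine ⟨p, hpA, ?_⟩
  have h₁ := hB.dist_add_dist hq
  have h₂ := hC.dist_add_dist hr
  have h₃ := hA.dist_add_dist hpA
  have h₄ := dist_triangle x r p
  have h₅ := dist_triangle x q p
  have h₆ := dist_triangle y r p
  have h₇ := dist_triangle z q p
  rw [dist_comm r p] at h₄ h₆
  rw [dist_comm q p] at h₅ h₇
  rw [dist_comm q x] at h₁
  rw [dist_comm r y] at h₂
  rw [dist_comm p z] at h₃
  rw [dist_comm z x] at h₁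
  linarith

/-- The point `p` of `[z, w]` nearly closest to `x` is `δ`-close to `[w, y]` or `[y, z]`; each case
gives one term of the maximum. The constant is `4 * (δ + 1)` for `p` plus `2 * δ` for the passage to
`q`. Geodesics are required only between points of `s`, which will be the vertices. -/
lemma four_point (hX : IsDeltaHyperbolic X δ) (hδ : 0 ≤ δ) {s : Set X}
    (hs : ∀ x ∈ s, ∀ y ∈ s, ∃ A, IsGeodesicSegment A x y) {x y z w : X} (hx : x ∈ s) (hy : y ∈ s)
    (hz : z ∈ s) (hw : w ∈ s) :
    dist x y + dist z w ≤ max (dist x z + dist y w) (dist x w + dist y z) + (6 * δ + 4) := by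
  obtain ⟨A, hA⟩ := hs z hz w hw
  obtain ⟨B, hB⟩ := hs w hw x hx
  obtain ⟨C, hC⟩ := hs x hx z hz
  obtain ⟨D, hD⟩ := hs w hw y hy
  obtain ⟨E, hE⟩ := hs y hy z hz
  obtain ⟨p, hp, hxp⟩ := hX.exists_mem_two_mul_dist_le hδ hA hB hC
  obtain ⟨q, hq, hpq⟩ := (hX y z w A D E hA hD hE).1 p hp
  have h := dist_triangle x p q
  rw [← sub_le_iff_le_add, le_max_iff]
  rcases hq with hq | hq
  · have h₁ := hD.dist_add_dist hq
    have h₂ := dist_triangle x q w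
    have h₃ := dist_triangle x q y
    rw [dist_comm q w] at h₂
    rw [dist_comm w y] at h₁
    left
    linarith
  · have h₁ := hE.dist_add_dist hq
    have h₂ := dist_triangle x q y
    have h₃ := dist_triangle x q z
    rw [dist_comm q y] at h₂
    right
    linarith

end IsDeltaHyperbolic

/-! ## Isometries of small displacement -/

namespace FourPointCondition

variable {X G : Type*} [PseudoMetricSpace X] [Group G] [MulAction G X] [IsIsometricSMul G X]
  {δ C K : ℝ}

/-- An almost fixed point `p` is almost equidistant from `x`, `u • x` and `u • u • x`, so the
four-point condition leaves no room for translation. The conclusion no longer mentions `p`, so it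
can be used for several isometries at a common `x`. -/
lemma dist_smul_smul_le (hX : FourPointCondition X δ) {u : G} {p : X} (hp : dist p (u • p) ≤ C)
    (x : X) : dist x (u • u • x) ≤ dist x (u • x) + (3 * C + δ) := by
  have h := hX x (u • u • x) (u • x) p
  have h₁ : dist (u • x) (u • p) = dist x p := dist_smul u x p
  have h₂ : dist (u • u • x) (u • u • p) = dist x p := by rw [dist_smul, dist_smul]
  have h₃ : dist (u • p) (u • u • p) = dist p (u • p) := dist_smul u _ _
  have h₄ : dist (u • u • x) (u • x) = dist x (u • x) := by rw [dist_smul, dist_comm]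
  have h₅ := dist_triangle_right (u • x) (u • p) p
  have h₆ := dist_triangle_right (u • u • x) p (u • u • p)
  have h₇ := dist_triangle p (u • p) (u • u • p)
  have h₈ : 0 ≤ dist p (u • p) := dist_nonneg
  rw [dist_comm (u • p) p] at h₅
  rcases le_total (dist x (u • x) + dist (u • u • x) p)
    (dist x p + dist (u • u • x) (u • x)) with h' | h'
  · rw [max_eq_right h'] at h
    linarith
  · rw [max_eq_left h'] at h
    linarith

/-- If `g`, `h` and `gh` are nearly elliptic, then the geodesics from `x` to `g⁻¹x` and to `hx`
nearly agree on half of the shorter one. -/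
lemma dist_inv_smul_smul_le (hX : FourPointCondition X δ) (hδ : 0 ≤ δ) (hK : 0 ≤ K) {g h : G} {x : X}
    (hg : dist x (g • g • x) ≤ dist x (g • x) + K) (hh : dist x (h • h • x) ≤ dist x (h • x) + K)
    (hgh : dist x ((g * h) • (g * h) • x) ≤ dist x ((g * h) • x) + K) :
    dist (g⁻¹ • x) (h • x) ≤ max (dist x (g • x)) (dist x (h • x)) + (2 * δ + K) := by
  have ea : dist x (g⁻¹ • x) = dist x (g • x) := by
    rw [← dist_smul g x (g⁻¹ • x), smul_inv_smul, dist_comm]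
  have eb : dist x (h⁻¹ • x) = dist x (h • x) := by
    rw [← dist_smul h x (h⁻¹ • x), smul_inv_smul, dist_comm]
  have eD : dist x ((g * h) • x) = dist (g⁻¹ • x) (h • x) := by
    rw [← dist_smul g⁻¹ x, mul_smul, inv_smul_smul]
  have eD' : dist x ((g * h)⁻¹ • x) = dist (g⁻¹ • x) (h • x) := by
    rw [← eD, ← dist_smul (g * h) x, smul_inv_smul, dist_comm]
  have eg : dist (g • x) (g⁻¹ • x) = dist x (g • g • x) := by
    rw [← dist_smul g (g • x), smul_inv_smul, dist_comm]
  have eh : dist (h • x) (h⁻¹ • x) = dist x (h • h • x) := by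
    rw [← dist_smul h (h • x), smul_inv_smul, dist_comm]
  have eu : dist ((g * h) • x) ((g * h)⁻¹ • x) = dist x ((g * h) • (g * h) • x) := by
    rw [← dist_smul (g * h) ((g * h) • x), smul_inv_smul, dist_comm]
  have e₁ : dist (g • x) ((g * h) • x) = dist x (h • x) := by rw [mul_smul, dist_smul]
  have e₂ : dist (h⁻¹ • x) ((g * h)⁻¹ • x) = dist x (g • x) := by
    rw [mul_inv_rev, mul_smul, dist_smul, ea]
  have q₁ := hX (h • x) (g⁻¹ • x) x (g • x)
  have q₂ := hX (h • x) (g • x) x (h⁻¹ • x)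
  have q₃ := hX (h⁻¹ • x) (g • x) x ((g * h) • x)
  have q₄ := hX (h⁻¹ • x) ((g * h) • x) x ((g * h)⁻¹ • x)
  simp only [dist_comm _ x, dist_comm (g⁻¹ • x) (g • x),
    dist_comm (g⁻¹ • x) (h • x), dist_comm (g • x) (h⁻¹ • x)]
    at ea eb eD eD' eg eh eu e₁ e₂ q₁ q₂ q₃ q₄ hg hh hgh ⊢
  rw [ea, eg] at q₁
  rw [eb, eh] at q₂
  rw [eb, e₁, eD] at q₃
  rw [eb, eD', eD, eu, e₂] at q₄
  rw [eD] at hgh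
  -- Write `a`, `b`, `D` for the displacements of `x` under `g`, `h`, `g * h`. If `D` is too large,
  -- `q₁` and `q₂` give `dist (g • x) (h⁻¹ • x) ≥ D - 2δ`, and `q₃` then gives `dist (h⁻¹ • x) ((g *
  -- h) • x) ≥ 2D - a - 3δ`. But `q₄` bounds the latter by `max (b + K) a + δ`, as `g * h` is nearly
  -- elliptic.
  by_contra! hlt
  grind

/-- Moving `x` along a geodesic from `x` to `g₀x` brings the displacement of `g` below the maximal
displacement `dist x (g₀x)`. -/
lemma dist_smul_le_of_dist_le (hX : FourPointCondition X δ) (hδ : 0 ≤ δ) {r : ℝ} {g g₀ : G}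
    {x y : X} (hK : 0 ≤ K) (hr : 2 * δ + 1 ≤ r)
    (hle : dist x (g • x) ≤ dist x (g₀ • x))
    (hxy : dist x y ≤ r) (hy : dist y (g₀ • x) ≤ dist x (g₀ • x) - r)
    (h₁ : dist (g • x) (g₀ • x) ≤ dist x (g₀ • x) + K)
    (h₂ : dist (g⁻¹ • x) (g₀ • x) ≤ dist x (g₀ • x) + K)
    (hB : 4 * r + K < dist x (g₀ • x)) : dist y (g • y) < dist x (g₀ • x) := by
  -- A small displacement grows by at most `2 * r`. For a large one, the threshold makes the second
  -- term win in `q₁` and `q₂`: `y` is closer than `x` to both `g • x` and `g⁻¹ • x` by at least `r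
  -- - δ`. Then `q₃` bounds the new displacement, using `2 * r > 3 * δ`.
  rcases lt_or_ge (dist x (g • x)) (2 * r + K) with h | h
  · have t₁ := dist_triangle4 y x (g • x) (g • y)
    rw [dist_smul, dist_comm y x] at t₁
    linarith
  · have ea : dist x (g⁻¹ • x) = dist x (g • x) := by
      rw [← dist_smul g x (g⁻¹ • x), smul_inv_smul, dist_comm]
    have e₁ : dist (g • y) x = dist y (g⁻¹ • x) := by rw [← dist_smul g y, smul_inv_smul]
    have q₁ := hX y (g • x) x (g₀ • x)
    have q₂ := hX y (g⁻¹ • x) x (g₀ • x)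
    have q₃ := hX y (g • y) x (g • x)
    have e₂ : dist (g • y) (g • x) = dist x y := by rw [dist_smul, dist_comm]
    rw [dist_comm (g • x) x, dist_comm y x] at q₁
    rw [dist_comm (g⁻¹ • x) x, dist_comm y x, ea] at q₂
    rw [e₁, e₂, dist_comm y x] at q₃
    grind

/-- A quantitative form of Serre's lemma: a finite symmetric set of isometries of a hyperbolic
graph, such that they and their products have bounded minimal displacement, has bounded joint
minimal displacement. -/
theorem exists_forall_dist_smul_le (hX : FourPointCondition X δ) (hδ : 0 ≤ δ) (hC : 0 ≤ C)
    (hint : ∀ x y : X, ∃ n : ℕ, dist x y = n)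
    (hgeo : ∀ (x y : X) (n : ℕ), (n : ℝ) ≤ dist x y → ∃ z, dist x z ≤ n ∧ dist z y ≤ dist x y - n)
    {T : Set G} (hTfin : T.Finite) (hTinv : ∀ g ∈ T, g⁻¹ ∈ T) [Nonempty X]
    (hT : ∀ g ∈ T, ∃ p : X, dist p (g • p) ≤ C)
    (hTT : ∀ g ∈ T, ∀ h ∈ T, ∃ p : X, dist p ((g * h) • p) ≤ C) :
    ∃ x : X, ∀ g ∈ T, dist x (g • x) ≤ 4 * (⌈2 * δ + 1⌉₊ : ℝ) + (2 * δ + (3 * C + δ)) := by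
  set r := ⌈2 * δ + 1⌉₊ with hr
  have hr' : 2 * δ + 1 ≤ r := Nat.le_ceil _
  have hK : 0 ≤ 3 * C + δ := by positivity
  have hpair : ∀ x : X, ∀ g ∈ T, ∀ h ∈ T, dist (g • x) (h • x) ≤
      max (dist x (g • x)) (dist x (h • x)) + (2 * δ + (3 * C + δ)) := by
    intro x g hg h hh
    obtain ⟨p, hp⟩ := hT _ (hTinv g hg)
    obtain ⟨p', hp'⟩ := hT h hh
    obtain ⟨p'', hp''⟩ := hTT _ (hTinv g hg) h hh
    have := hX.dist_inv_smul_smul_le hδ hK (hX.dist_smul_smul_le hp x)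
      (hX.dist_smul_smul_le hp' x) (hX.dist_smul_smul_le hp'' x)
    rwa [inv_inv, show dist x (g⁻¹ • x) = dist x (g • x) by
      rw [← dist_smul g x (g⁻¹ • x), smul_inv_smul, dist_comm]] at this
  have key : ∀ (n : ℕ) (x : X), (∀ g ∈ T, dist x (g • x) ≤ n) →
      ∃ x : X, ∀ g ∈ T, dist x (g • x) ≤ 4 * (r : ℝ) + (2 * δ + (3 * C + δ)) := by
    intro n
    induction n with
    | zero =>
      intro x hx
      refine ⟨x, fun g hg => (hx g hg).trans ?_⟩
      rw [Nat.cast_zero]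
      positivity
    | succ n ih =>
      intro x hx
      -- Distances are integers, so a strict decrease lowers the bound by one and the descent
      -- terminates.
      have hlt : ∀ y : X, (∀ g ∈ T, dist y (g • y) < (n + 1 : ℕ)) →
          ∀ g ∈ T, dist y (g • y) ≤ n := by
        intro y hy g hg
        have := hy g hg
        obtain ⟨m, hm⟩ := hint y (g • y)
        rw [hm] at this ⊢
        exact_mod_cast Nat.lt_succ_iff.mp (by exact_mod_cast this)
      by_cases hmax : ∃ g₀ ∈ T, (n + 1 : ℕ) ≤ dist x (g₀ • x)
      · obtain ⟨g₀, hg₀, hle⟩ := hmax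
        have heq := le_antisymm (hx g₀ hg₀) hle
        rcases le_or_gt ((n + 1 : ℕ) : ℝ) (4 * (r : ℝ) + (2 * δ + (3 * C + δ))) with hB | hB
        · exact ⟨x, fun g hg => (hx g hg).trans hB⟩
        · rw [← heq] at hx hB hlt
          -- The new point depends on `g₀` alone, so it serves all `g ∈ T` simultaneously.
          obtain ⟨y, hxy, hy⟩ := hgeo x (g₀ • x) r (by linarith)
          refine ih y (hlt y fun g hg => ?_)
          have hp₁ := hpair x g hg g₀ hg₀
          have hp₂ := hpair x g⁻¹ (hTinv g hg) g₀ hg₀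
          rw [max_eq_right (hx _ hg)] at hp₁
          rw [max_eq_right (hx _ (hTinv g hg))] at hp₂
          exact hX.dist_smul_le_of_dist_le hδ (by positivity) hr' (hx g hg) hxy hy hp₁ hp₂ hB
      · push Not at hmax
        exact ih x (hlt x hmax)
  obtain ⟨x⟩ := ‹Nonempty X›
  obtain ⟨M, hM⟩ := (hTfin.image fun g => dist x (g • x)).bddAbove
  obtain ⟨n, hn⟩ := exists_nat_ge M
  exact key n x fun g hg => (hM ⟨g, hg, rfl⟩).trans hn

end FourPointCondition

/-! ## Vertices in the realization of a graph -/

namespace SimpleGraph.Realization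

variable {V : Type*} {Γ : SimpleGraph V}

/-- The piecewise linear extension of the distance to the vertex `u`. -/
noncomputable def distExtension (Γ : SimpleGraph V) (u : V) (x : Γ.Realization) : ℝ :=
  x.coord.sum fun w r => r * Γ.dist u w

lemma distExtension_vertex (u v : V) : distExtension Γ u (vertex Γ v) = Γ.dist u v := by
  simp [distExtension, vertex]

lemma coord_sum_eq {x : Γ.Realization} {e : Finset V} (h : x.coord.support ⊆ e) :
    ∑ v ∈ e, x.coord v = 1 := by
  rw [← x.coord_sum, Finsupp.sum_of_support_subset _ h _ (by simp)]

lemma segmentLength_eq {x y : Γ.Realization} {e : Finset V} (hx : x.coord.support ⊆ e)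
    (hy : y.coord.support ⊆ e) : segmentLength x y = (∑ v ∈ e, |x.coord v - y.coord v|) / 2 := by
  classical
  rw [segmentLength, Finsupp.sum_of_support_subset (s := e) _ _ _ (by simp)]
  · rfl
  · exact Finsupp.support_sub.trans (Finset.union_subset hx hy)

/-- The function is affine on an edge, and its values at the two ends differ by at most 1. Being
1-Lipschitz, it shows that paths through the realization are no shorter than walks. -/
lemma abs_distExtension_sub_le (hΓ : Γ.Connected) (u : V) {x y : Γ.Realization}
    (h : OnCommonCell x y) :
    |distExtension Γ u x - distExtension Γ u y| ≤ segmentLength x y := by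
  classical
  obtain ⟨e, ⟨hclique, hcard⟩, hx, hy⟩ := h
  have sx := coord_sum_eq hx
  have sy := coord_sum_eq hy
  rw [segmentLength_eq hx hy, distExtension, distExtension,
    Finsupp.sum_of_support_subset _ hx _ (by simp), Finsupp.sum_of_support_subset _ hy _ (by simp)]
  interval_cases hc : e.card
  · rw [Finset.card_eq_zero] at hc
    simp [hc]
  · obtain ⟨a, rfl⟩ := Finset.card_eq_one.mp hc
    simp only [Finset.sum_singleton] at sx sy ⊢
    simp [sx, sy]
  · obtain ⟨a, b, hab, rfl⟩ := Finset.card_eq_two.mp hc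
    have hadj : Γ.Adj a b := hclique (by simp) (by simp) hab
    have h₁ : Γ.dist u b ≤ Γ.dist u a + 1 := by
      simpa [dist_eq_one_iff_adj.mpr hadj] using hΓ.dist_triangle (u := u) (v := a) (w := b)
    have h₂ : Γ.dist u a ≤ Γ.dist u b + 1 := by
      simpa [dist_eq_one_iff_adj.mpr hadj.symm] using hΓ.dist_triangle (u := u) (v := b) (w := a)
    have h₁' : (Γ.dist u b : ℝ) ≤ Γ.dist u a + 1 := by exact_mod_cast h₁
    have h₂' : (Γ.dist u a : ℝ) ≤ Γ.dist u b + 1 := by exact_mod_cast h₂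
    rw [Finset.sum_pair hab] at sx sy
    simp only [Finset.sum_pair hab]
    have ex : x.coord b = 1 - x.coord a := by linarith
    have ey : y.coord b = 1 - y.coord a := by linarith
    rw [ex, ey, show x.coord a * (Γ.dist u a : ℝ) + (1 - x.coord a) * (Γ.dist u b : ℝ) -
      (y.coord a * (Γ.dist u a : ℝ) + (1 - y.coord a) * (Γ.dist u b : ℝ)) =
      (x.coord a - y.coord a) * (Γ.dist u a - Γ.dist u b) by ring,
      show 1 - x.coord a - (1 - y.coord a) = -(x.coord a - y.coord a) by ring, abs_neg, abs_mul,
      add_self_div_two]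
    refine mul_le_of_le_one_right (abs_nonneg _) (abs_le.mpr ⟨?_, ?_⟩) <;> linarith

lemma IsPathLength.abs_distExtension_sub_le (hΓ : Γ.Connected) (u : V) {x y : Γ.Realization} {ℓ : ℝ}
    (h : IsPathLength x y ℓ) : |distExtension Γ u x - distExtension Γ u y| ≤ ℓ := by
  induction h with
  | nil x => simp
  | @cons x y z ℓ hxy _ ih =>
    have h₁ := Realization.abs_distExtension_sub_le hΓ u hxy
    have h₂ := _root_.abs_sub_le (distExtension Γ u x) (distExtension Γ u y) (distExtension Γ u z)
    linarith

/-- The point at distance `t` from `u` on the edge `{u, v}`. -/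
noncomputable def edgePoint {u v : V} (h : Γ.Adj u v) (t : ℝ) (ht : t ∈ Set.Icc (0 : ℝ) 1) :
    Γ.Realization where
  coord := Finsupp.single u (1 - t) + Finsupp.single v t
  coord_nonneg w := by
    have h₁ : 0 ≤ 1 - t := by linarith [ht.2]
    have h₂ := ht.1
    rw [Finsupp.add_apply]
    classical
    rw [Finsupp.single_apply, Finsupp.single_apply]
    split_ifs <;> simp_all
  coord_sum := by
    rw [Finsupp.sum_add_index' (by simp) (by simp), Finsupp.sum_single_index rfl,
      Finsupp.sum_single_index rfl, sub_add_cancel]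
  isCell_support := by
    classical
    have hsub : (Finsupp.single u (1 - t) + Finsupp.single v t).support ⊆ {u, v} := by
      refine Finsupp.support_add.trans (Finset.union_subset ?_ ?_) <;>
      exact Finsupp.support_single_subset.trans (by simp)
    refine ⟨IsClique.subset (Finset.coe_subset.mpr hsub) ?_,
      (Finset.card_le_card hsub).trans Finset.card_le_two⟩
    simpa using fun _ => h

section edgePoint

variable {u v : V} (h : Γ.Adj u v)

lemma support_edgePoint_subset [DecidableEq V] (t : ℝ) (ht : t ∈ Set.Icc (0 : ℝ) 1) :
    (edgePoint h t ht).coord.support ⊆ {u, v} := by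
  refine Finsupp.support_add.trans (Finset.union_subset ?_ ?_) <;>
  exact Finsupp.support_single_subset.trans (by simp)

lemma edgePoint_zero (ht : (0 : ℝ) ∈ Set.Icc (0 : ℝ) 1) : edgePoint h 0 ht = vertex Γ u := by
  ext1
  simp [edgePoint, vertex]

lemma edgePoint_one (ht : (1 : ℝ) ∈ Set.Icc (0 : ℝ) 1) : edgePoint h 1 ht = vertex Γ v := by
  ext1
  simp [edgePoint, vertex]

lemma isPathLength_edgePoint (s t : ℝ) (hs : s ∈ Set.Icc (0 : ℝ) 1) (ht : t ∈ Set.Icc (0 : ℝ) 1) :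
    IsPathLength (edgePoint h s hs) (edgePoint h t ht) |s - t| := by
  classical
  have hsub := support_edgePoint_subset h s hs
  have hsub' := support_edgePoint_subset h t ht
  have hlen : segmentLength (edgePoint h s hs) (edgePoint h t ht) = |s - t| := by
    rw [segmentLength_eq hsub hsub', Finset.sum_pair h.ne]
    simp only [edgePoint, Finsupp.add_apply, Finsupp.single_eq_same,
      Finsupp.single_eq_of_ne h.ne, Finsupp.single_eq_of_ne h.ne.symm, add_zero, zero_add]
    rw [sub_sub_sub_cancel_left, abs_sub_comm t, add_self_div_two]
  rw [← hlen]
  exact .single ⟨{u, v}, ⟨by simpa using fun _ => h, Finset.card_le_two⟩, hsub, hsub'⟩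

end edgePoint

/-! ### Comparison of the path metric with the graph metric -/

section metric

variable (hΓ : Γ.Connected)

lemma IsPathLength.dist_le {x y : Γ.Realization} {ℓ : ℝ} (h : IsPathLength x y ℓ) :
    (metricSpace hΓ).dist x y ≤ ℓ :=
  csInf_le (bddBelow_isPathLength x y) h

/-- A walk traversed with unit speed. -/
lemma exists_path_of_walk {u v : V} (p : Γ.Walk u v) :
    ∃ γ : ℝ → Γ.Realization, γ 0 = vertex Γ u ∧ γ p.length = vertex Γ v ∧
      ∀ s t : ℝ, 0 ≤ s → s ≤ t → t ≤ p.length → (metricSpace hΓ).dist (γ s) (γ t) ≤ t - s := by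
  let := metricSpace hΓ
  induction p with
  | @nil u => exact ⟨fun _ => vertex Γ u, rfl, rfl, fun s t _ hst _ => by simpa using hst⟩
  | @cons u v w h p ih =>
    obtain ⟨γ, h0, h1, hγ⟩ := ih
    have hE : ∀ (s t : ℝ) (hs : s ∈ Set.Icc (0 : ℝ) 1) (ht : t ∈ Set.Icc (0 : ℝ) 1), s ≤ t →
        Dist.dist (edgePoint h s hs) (edgePoint h t ht) ≤ t - s := fun s t hs ht hst => by
      rw [← abs_of_nonneg (sub_nonneg.mpr hst), abs_sub_comm]
      exact (isPathLength_edgePoint h s t hs ht).dist_le hΓ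
    let η : ℝ → Γ.Realization := fun t =>
      if ht : t ∈ Set.Icc (0 : ℝ) 1 then edgePoint h t ht else γ (t - 1)
    have hη₁ : ∀ t (ht : t ∈ Set.Icc (0 : ℝ) 1), η t = edgePoint h t ht := fun t ht => dif_pos ht
    have hη₂ : ∀ t, 1 ≤ t → η t = γ (t - 1) := fun t ht => by
      rcases ht.eq_or_lt with rfl | ht
      · rw [hη₁ 1 (by simp), edgePoint_one, sub_self, h0]
      · exact dif_neg fun h' => (h'.2.trans_lt ht).false
    refine ⟨η, ?_, ?_, fun s t hs hst ht => ?_⟩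
    · rw [hη₁ 0 (by simp), edgePoint_zero]
    · rw [hη₂ _ (by simp), Walk.length_cons, Nat.cast_add, Nat.cast_one, add_sub_cancel_right, h1]
    · rw [Walk.length_cons, Nat.cast_add, Nat.cast_one] at ht
      rcases le_total t 1 with ht1 | ht1
      · rw [hη₁ s ⟨hs, hst.trans ht1⟩, hη₁ t ⟨hs.trans hst, ht1⟩]
        exact hE _ _ _ _ hst
      · rcases le_total s 1 with hs1 | hs1
        · have h₁ := hE s 1 ⟨hs, hs1⟩ (by simp) hs1
          rw [edgePoint_one, ← h0] at h₁
          have h₂ := hγ 0 (t - 1) le_rfl (by linarith) (by linarith)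
          rw [hη₁ s ⟨hs, hs1⟩, hη₂ t ht1]
          refine (dist_triangle _ (γ 0) _).trans ((add_le_add h₁ h₂).trans_eq (by ring))
        · rw [hη₂ s hs1, hη₂ t ht1]
          exact (hγ _ _ (by linarith) (by linarith) (by linarith)).trans_eq (by ring)

/-- The metric of the realization extends the graph metric. -/
lemma dist_vertex (u v : V) : (metricSpace hΓ).dist (vertex Γ u) (vertex Γ v) = Γ.dist u v := by
  refine le_antisymm ?_ (le_csInf (exists_isPathLength hΓ _ _) fun ℓ hℓ => ?_)
  · obtain ⟨p, hp⟩ := hΓ.exists_walk_length_eq_dist u v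
    obtain ⟨γ, h0, h1, hγ⟩ := exists_path_of_walk hΓ p
    have := hγ 0 p.length le_rfl (by positivity) le_rfl
    rwa [h0, h1, sub_zero, hp] at this
  · have := hℓ.abs_distExtension_sub_le hΓ u
    rw [distExtension_vertex, distExtension_vertex, SimpleGraph.dist_self] at this
    simpa using this

lemma exists_isGeodesicSegment_vertex (u v : V) :
    ∃ A : Set Γ.Realization, @IsGeodesicSegment _ (metricSpace hΓ) A (vertex Γ u) (vertex Γ v) := by
  let := metricSpace hΓ
  obtain ⟨p, hp⟩ := hΓ.exists_walk_length_eq_dist u v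
  obtain ⟨γ, h0, h1, hγ⟩ := exists_path_of_walk hΓ p
  have hd : Dist.dist (γ 0) (γ p.length) = p.length := by rw [h0, h1, hp]; exact dist_vertex hΓ u v
  -- The upper bounds on the three pieces add up to the distance between the endpoints, so each is
  -- an equality.
  have key : ∀ s t : ℝ, 0 ≤ s → s ≤ t → t ≤ p.length → Dist.dist (γ s) (γ t) = t - s := by
    intro s t hs hst ht
    have h₁ : Dist.dist (γ 0) (γ s) ≤ s - 0 := hγ 0 s le_rfl hs (hst.trans ht)
    have h₂ : Dist.dist (γ s) (γ t) ≤ t - s := hγ s t hs hst ht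
    have h₃ : Dist.dist (γ t) (γ p.length) ≤ p.length - t := hγ t _ (hs.trans hst) ht le_rfl
    have h₄ := dist_triangle4 (γ 0) (γ s) (γ t) (γ p.length)
    linarith
  refine ⟨_, p.length, γ, by positivity, h0, h1, fun s hs t ht => ?_, rfl⟩
  rcases le_total s t with hst | hst
  · rw [key s t hs.1 hst ht.2, abs_sub_comm, abs_of_nonneg (by linarith)]
  · rw [_root_.dist_comm, key t s ht.1 hst hs.2, abs_of_nonneg (by linarith)]

end metric

end SimpleGraph.Realization

/-! ## The word metric -/

namespace SimpleGraph

variable {G : Type*} [Group G] {S : Set G}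

lemma mulCayley_dist_mul_le (hS : Subgroup.closure S = ⊤) (g x y : G) :
    (mulCayley S).dist (g * x) (g * y) ≤ (mulCayley S).dist x y := by
  obtain ⟨p, hp⟩ := (mulCayley_connected hS).exists_walk_length_eq_dist x y
  let φ : mulCayley S →g mulCayley S :=
    ⟨fun x => g * x, fun {a b} h => by
      rw [mulCayley_adj] at h ⊢
      simpa [mul_assoc] using h⟩
  rw [← hp, ← Walk.length_map φ p]
  exact dist_le (p.map φ)

lemma mulCayley_dist_mul (hS : Subgroup.closure S = ⊤) (g x y : G) :
    (mulCayley S).dist (g * x) (g * y) = (mulCayley S).dist x y := by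
  refine le_antisymm (mulCayley_dist_mul_le hS g x y) ?_
  simpa using mulCayley_dist_mul_le hS g⁻¹ (g * x) (g * y)

lemma mulCayley_dist_mul_right_le_one {s : G} (hs : s ∈ S) (x : G) :
    (mulCayley S).dist x (x * s) ≤ 1 := by
  by_cases h : x = x * s
  · rw [← h, dist_self]
    exact zero_le_one
  · exact (dist_eq_one_iff_adj.mpr ((mulCayley_adj S _ _).mpr ⟨h, by simp [hs]⟩)).le

lemma finite_mulCayley_ball (hS : Subgroup.closure S = ⊤) (hfin : S.Finite) (n : ℕ) :
    {g | (mulCayley S).dist 1 g ≤ n}.Finite := by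
  -- Walks end at `1` so that removing the first edge leaves a shorter walk of the same kind, from a
  -- neighbour `v` of `g`.
  have key : ∀ n : ℕ, {g | ∃ p : (mulCayley S).Walk g 1, p.length ≤ n}.Finite := by
    intro n
    induction n with
    | zero =>
      refine (Set.finite_singleton (1 : G)).subset ?_
      rintro g ⟨p, hp⟩
      exact Walk.eq_of_length_eq_zero (Nat.le_zero.mp hp)
    | succ n ih =>
      refine (ih.union ((ih.mul hfin).union (ih.mul hfin.inv))).subset ?_
      rintro g ⟨p, hp⟩
      cases p with
      | nil => exact Or.inl ⟨.nil, Nat.zero_le _⟩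
      | @cons _ v _ h p =>
        rw [Walk.length_cons, Nat.add_le_add_iff_right] at hp
        right
        rcases ((mulCayley_adj S _ _).mp h).2 with h | h
        · exact Or.inr ⟨v, ⟨p, hp⟩, _, Set.inv_mem_inv.mpr h, by simp⟩
        · exact Or.inl ⟨v, ⟨p, hp⟩, _, h, by simp⟩
  refine (key n).subset fun g hg => ?_
  obtain ⟨p, hp⟩ := (mulCayley_connected hS).exists_walk_length_eq_dist g 1
  exact ⟨p, (hp.trans dist_comm).trans_le hg⟩

end SimpleGraph

/-! ## Conjugating automorphisms of hyperbolic groups -/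

open SimpleGraph Realization in
/-- Up to an inner automorphism, a conjugating automorphism of a hyperbolic group sends the
generators into a fixed ball. -/
lemma exists_forall_conjAut_dist_le {G : Type*} [Group G] {S : Set G}
    (hS : Subgroup.closure S = ⊤) (hfin : S.Finite) (hinv : ∀ s ∈ S, s⁻¹ ∈ S) {δ : ℝ} (hδ : 0 ≤ δ)
    (hyp : IsDeltaHyperbolic (CayleySpace S hS) δ) :
    ∃ n : ℕ, ∀ f ∈ conjAut G, ∃ x : G, ∀ s ∈ S, (mulCayley S).dist 1 (x⁻¹ * f s * x) ≤ n := by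
  have hΓ := mulCayley_connected hS
  let v : G → CayleySpace S hS := vertex (mulCayley S)
  -- Working on the vertices alone gives integer distances and an isometric action by left
  -- multiplication.
  let : PseudoMetricSpace G := PseudoMetricSpace.induced v inferInstance
  have hdist : ∀ x y : G, dist x y = (mulCayley S).dist x y := dist_vertex hΓ
  have : IsIsometricSMul G G := ⟨fun g => Isometry.of_dist_eq fun x y => by
    rw [hdist, hdist, smul_eq_mul, smul_eq_mul, mulCayley_dist_mul hS]⟩
  have h4 : FourPointCondition G (6 * δ + 4) := fun x y z w =>
    hyp.four_point hδ (s := Set.range v)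
      (by
        rintro _ ⟨a, rfl⟩ _ ⟨b, rfl⟩
        exact exists_isGeodesicSegment_vertex hΓ a b)
      ⟨x, rfl⟩ ⟨y, rfl⟩ ⟨z, rfl⟩ ⟨w, rfl⟩
  have hgeo : ∀ (x y : G) (n : ℕ), (n : ℝ) ≤ dist x y →
      ∃ z, dist x z ≤ n ∧ dist z y ≤ dist x y - n := by
    intro x y n hn
    obtain ⟨p, hp⟩ := hΓ.exists_walk_length_eq_dist x y
    rw [hdist, Nat.cast_le] at hn
    refine ⟨p.getVert n, ?_, ?_⟩
    · rw [hdist, Nat.cast_le]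
      exact (dist_le (p.take n)).trans (by rw [Walk.take_length]; exact min_le_left _ _)
    · rw [hdist, hdist, ← Nat.cast_sub hn, Nat.cast_le, ← hp, ← Walk.drop_length]
      exact dist_le (p.drop n)
  -- For `u = p * g * p⁻¹` the point `p` goes to `p * g`.
  have hconj : ∀ g u : G, IsConj g u → ∃ p : G, dist p (u • p) = Dist.dist 1 g := by
    intro g u h
    obtain ⟨p, rfl⟩ := isConj_iff.mp h
    refine ⟨p, ?_⟩
    rw [hdist, hdist, smul_eq_mul, inv_mul_cancel_right]
    simpa using mulCayley_dist_mul hS p 1 g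
  have hone : ∀ s ∈ S, Dist.dist 1 s ≤ 1 := fun s hs => by
    rw [hdist]
    exact_mod_cast (one_mul s ▸ mulCayley_dist_mul_right_le_one hs 1 : (mulCayley S).dist 1 s ≤ 1)
  have htwo : ∀ s ∈ S, ∀ t ∈ S, Dist.dist 1 (s * t) ≤ 2 := fun s hs t ht => by
    refine (dist_triangle 1 s _).trans ?_
    have : dist s (s * t) ≤ 1 := by
      rw [hdist]
      exact_mod_cast mulCayley_dist_mul_right_le_one ht s
    linarith [hone s hs]
  -- The Serre bound with four-point constant `6 * δ + 4` and displacement `C = 2`.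
  refine ⟨⌈4 * (⌈2 * (6 * δ + 4) + 1⌉₊ : ℝ) + (2 * (6 * δ + 4) + (3 * 2 + (6 * δ + 4)))⌉₊,
    fun f hf => ?_⟩
  obtain ⟨x, hx⟩ := h4.exists_forall_dist_smul_le (by positivity) zero_le_two
    (fun x y => ⟨_, hdist x y⟩) hgeo (T := f '' S) (hfin.image f)
    (by
      rintro _ ⟨s, hs, rfl⟩
      exact ⟨s⁻¹, hinv s hs, map_inv f s⟩)
    (by
      rintro _ ⟨s, hs, rfl⟩
      obtain ⟨p, hp⟩ := hconj s (f s) (hf s)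
      exact ⟨p, by linarith [hone s hs]⟩)
    (by
      rintro _ ⟨s, hs, rfl⟩ _ ⟨t, ht, rfl⟩
      obtain ⟨p, hp⟩ := hconj (s * t) (f (s * t)) (hf _)
      rw [map_mul] at hp
      exact ⟨p, hp.trans_le (htwo s hs t ht)⟩)
  refine ⟨x, fun s hs => ?_⟩
  have := (hx (f s) ⟨s, hs, rfl⟩).trans (Nat.le_ceil _)
  rw [hdist, Nat.cast_le] at this
  rwa [← mulCayley_dist_mul hS x, mul_one, mul_assoc, mul_inv_cancel_left]

/-- The automorphisms sending a finite generating set into a finite set form a finite set. -/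
lemma finite_setOf_mulAut_forall_mem {G : Type*} [Group G] {S B : Set G}
    (hS : Subgroup.closure S = ⊤) (hfin : S.Finite) (hB : B.Finite) :
    {φ : MulAut G | ∀ s ∈ S, φ s ∈ B}.Finite := by
  have := hfin.to_subtype
  have := hB.to_subtype
  refine Finite.of_injective (β := S → B) (fun φ s => ⟨φ.1 s, φ.2 s s.2⟩) fun φ ψ h => ?_
  refine Subtype.ext (MulEquiv.toMonoidHom_injective (MonoidHom.eq_of_eqOn_dense hS fun s hs => ?_))
  exact congrArg Subtype.val (congrFun h ⟨s, hs⟩)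

/-- For a hyperbolic group `G`, the subgroup `Inn(G)` has finite index in `Conj(G)`. -/
theorem lemma2p2 (G : Type*) [Group G] (hG : IsHyperbolicGroup G) :
    innAut G ≤ conjAut G ∧ ((innAut G).subgroupOf (conjAut G)).FiniteIndex := by
  refine ⟨innAut_le_conjAut G, ?_⟩
  obtain ⟨S, hS, hfin, hinv, δ, hδ, hyp⟩ := hG
  obtain ⟨n, hn⟩ := exists_forall_conjAut_dist_le hS hfin hinv hδ hyp
  choose x hx using hn
  have hT := finite_setOf_mulAut_forall_mem hS hfin (SimpleGraph.finite_mulCayley_ball hS hfin n)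
  have := hT.to_subtype
  -- Each coset goes to its chosen representative, corrected by an inner automorphism so as to send
  -- `S` into the ball.
  let F : conjAut G ⧸ (innAut G).subgroupOf (conjAut G) →
      {φ : MulAut G | ∀ s ∈ S, φ s ∈ {g | (SimpleGraph.mulCayley S).dist 1 g ≤ n}} := fun q =>
    ⟨MulAut.conj (x q.out.1 q.out.2)⁻¹ * q.out.1, fun s hs => by
      simpa using hx q.out.1 q.out.2 s hs⟩
  have hF : Function.Injective F := by
    intro q q' h
    have h' : MulAut.conj (x q.out.1 q.out.2)⁻¹ * q.out.1 =
      MulAut.conj (x q'.out.1 q'.out.2)⁻¹ * q'.out.1 := congrArg Subtype.val h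
    rw [← q.out_eq', ← q'.out_eq', QuotientGroup.eq, Subgroup.mem_subgroupOf]
    generalize x q.out.1 q.out.2 = a at h'
    generalize x q'.out.1 q'.out.2 = b at h'
    have hq : q'.out.1 = MulAut.conj b * (MulAut.conj a⁻¹ * q.out.1) := by
      rw [h', map_inv, mul_inv_cancel_left]
    -- For `φ = q.out.1`, the quotient of the representatives is `φ⁻¹ * conj (b * a⁻¹) * φ`, which
    -- is conjugation by `φ⁻¹ (b * a⁻¹)`.
    refine ⟨q.out.1⁻¹ (b * a⁻¹), ?_⟩
    rw [Subgroup.coe_mul, hq]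
    ext g
    simp [mul_assoc]
  have := Finite.of_injective F hF
  exact Subgroup.finiteIndex_of_finite_quotient
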